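/- For a primitive matrix $B$ with entries in $\{0,1,2,\dots\}$ (that is, a square matrix of positive size some power of which has all entries positive), let $\lambda_B$ be its Perron–Frobenius eigenvalue (the spectral radius), let $x=(x_1,\dots,x_m)^T$ be its normalized Perron–Frobenius eigenvector (so $Bx=\lambda_B x$, all $x_i>0$ and $\sum_i x_i=1$), let $H(x)$ be the additive subgroup of $\mathbb{R}$ generated by $x_1,\dots,x_m$, and put $S(B)=\bigcup_{N=0}^{\infty}\lambda_B^{-N}H(x)\subset\mathbb{R}$. Let $A$ be a primitive $s\times s$ matrix with entries in $\{0,1,2,\dots\}$, let $\lambda=\lambda_A$, and let $k$ be the degree of the algebraic number $\lambda$ over $\mathbb{Q}$. Suppose $k\ge 2$. Then there exist a primitive $k\times k$ matrix $\widetilde A$ with entries in $\{0,1,2,\dots\}$ and a positive number $\alpha\in\mathbb{Q}(\lambda)$ such that $S(\widetilde A)=\alpha S(A)$. Moreover, $k$ is the least possible dimension: if $P$ is a primitive $l\times l$ matrix with entries in $\{0,1,2,\dots\}$ and $S(P)=\alpha S(A)$ for some $\alpha\in\mathbb{R}$, then $l\ge k$. -/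

import Mathlib

open scoped Pointwise

noncomputable section

namespace PerronClopen

/-- A square matrix with entries in `ℕ = {0, 1, 2, …}` is primitive if some positive power of it
is entrywise strictly positive. -/
def Primitive {s : ℕ} (A : Matrix (Fin s) (Fin s) ℕ) : Prop :=
  (A.map (fun n : ℕ => (n : ℝ))).IsPrimitive

/-- The Perron–Frobenius eigenvalue of a nonnegative matrix: its spectral radius, i.e. the largest
absolute value of a complex eigenvalue. -/
def perronRoot {s : ℕ} (A : Matrix (Fin s) (Fin s) ℕ) : ℝ :=
  (spectralRadius ℂ (A.map (fun n : ℕ => (n : ℂ)))).toReal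

/-- `x` is a normalized Perron–Frobenius eigenvector of `A`: an eigenvector for the
Perron–Frobenius eigenvalue with positive coordinates of sum `1`.
For a primitive matrix of positive size there is exactly one. -/
structure IsNormalizedPerronVector {s : ℕ} (A : Matrix (Fin s) (Fin s) ℕ) (x : Fin s → ℝ) :
    Prop where
  pos : ∀ i, 0 < x i
  eigen : (A.map (fun n : ℕ => (n : ℝ))).mulVec x = perronRoot A • x
  sum_eq_one : ∑ i, x i = 1

/-- The additive subgroup `H(x)` of `ℝ` generated by the coordinates of `x`. -/
def H {s : ℕ} (x : Fin s → ℝ) : AddSubgroup ℝ :=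
  AddSubgroup.closure (Set.range x)

/-- `S(A) = ⋃_{N ≥ 0} λ^{-N} H(x)`, where `λ` is the Perron–Frobenius eigenvalue of `A` and `x` is
the normalized Perron–Frobenius eigenvector (the outer union only introduces this unique `x`). -/
def S {s : ℕ} (A : Matrix (Fin s) (Fin s) ℕ) : Set ℝ :=
  ⋃ (x : Fin s → ℝ) (_ : IsNormalizedPerronVector A x) (N : ℕ),
    (1 / perronRoot A ^ N) • (H x : Set ℝ)

end PerronClopen

end

/-! Let `x` be the normalized Perron vector of `A`. Simplicity of `λ` puts its coordinates in
`ℚ(λ)`, and `H x` is stable under `λ`, so `H x` is free of rank `k` (`card_basis`). An Elliott-type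
lemma (`exists_pos_basis`) gives a positive basis `y` of `H x` with every `x i` a nonnegative
integer combination of `y`. Write `y = C x` with `C` integral and `x = D y` with `D` over `ℕ`. Since
`C x > 0`, Perron–Frobenius asymptotics make `C A^e` positive for suitable large `e`, so `B = C A^e
D` is a positive integer matrix with `B y = λ^e y` (`exists_pos_matrix`). Hence `λ_B = λ^e`, and
normalizing `y` only scales `H x`; using `λ^e` in place of `λ` does not change the union because `λ
H x ⊆ H x`.

Minimality is a rank count: if `S P = α S A`, a power of `λ_P` moves the `k` rationally independent
numbers `α λ^j x i₀`, `j < k`, into a group with `l` generators. -/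

namespace PerronClopen

/-! ### Perron–Frobenius theory for primitive matrices. -/

section Perron

open Matrix

variable {n : Type*} [Fintype n]

theorem pow_mulVec_eigen [DecidableEq n] {R : Type*} [CommRing R] {M : Matrix n n R} {x : n → R} {t : R}
    (h : M *ᵥ x = t • x) (m : ℕ) : (M ^ m) *ᵥ x = t ^ m • x := by
  induction m with
  | zero => simp
  | succ m ih => rw [pow_succ, ← mulVec_mulVec, h, mulVec_smul, ih, smul_smul, pow_succ, mul_comm]

theorem mulVec_pos_of_pos {M : Matrix n n ℝ} (hM : ∀ i j, 0 < M i j) {u : n → ℝ}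
    (hu : ∀ i, 0 ≤ u i) (hu0 : u ≠ 0) (i : n) : 0 < (M *ᵥ u) i := by
  obtain ⟨j, hj⟩ := Function.ne_iff.mp hu0
  exact Finset.sum_pos' (fun k _ => mul_nonneg (hM i k).le (hu k))
    ⟨j, Finset.mem_univ j, mul_pos (hM i j) (lt_of_le_of_ne (hu j) (Ne.symm hj))⟩

/-- The Perron–Frobenius theorem, existence part. -/
theorem exists_pos_eigenvector [DecidableEq n] [Nonempty n] {M : Matrix n n ℝ} (hM : M.IsPrimitive) :
    ∃ (t : ℝ) (x : n → ℝ), (∀ i, 0 < x i) ∧ ∑ i, x i = 1 ∧ M *ᵥ x = t • x := by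
  obtain ⟨h0, m, -, hm⟩ := hM
  set C : ℝ := ∑ i, ∑ j, M i j with hC
  -- Collatz–Wielandt: `t` is maximized subject to `t p ≤ M p` on the simplex. Summing coordinates
  -- gives `t ≤ C`, so this bound costs nothing and makes `K` compact.
  let K : Set (ℝ × (n → ℝ)) :=
    (Set.Icc 0 C ×ˢ stdSimplex ℝ n) ∩ {q | ∀ i, q.1 * q.2 i ≤ (M *ᵥ q.2) i}
  have hKc : IsCompact K := by
    refine (isCompact_Icc.prod (isCompact_stdSimplex ℝ n)).inter_right ?_
    simp only [Set.ofPred_forall, mulVec, dotProduct]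
    exact isClosed_iInter fun i => isClosed_le (by fun_prop) (by fun_prop)
  have hmem : ∀ (t : ℝ) (p : n → ℝ), 0 ≤ t → p ∈ stdSimplex ℝ n →
      (∀ i, t * p i ≤ (M *ᵥ p) i) → (t, p) ∈ K := by
    intro t p ht hp h
    refine ⟨⟨⟨ht, ?_⟩, hp⟩, h⟩
    calc t = ∑ i, t * p i := by rw [← Finset.mul_sum, hp.2, mul_one]
      _ ≤ ∑ i, (M *ᵥ p) i := Finset.sum_le_sum fun i _ => h i
      _ ≤ C := Finset.sum_le_sum fun i _ => Finset.sum_le_sum fun j _ =>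
        mul_le_of_le_one_right (h0 i j) (mem_Icc_of_mem_stdSimplex hp j).2
  have hKn : K.Nonempty := by
    obtain ⟨i⟩ := ‹Nonempty n›
    refine ⟨(0, Pi.single i 1), hmem _ _ le_rfl (single_mem_stdSimplex ℝ i) fun j => ?_⟩
    simpa using h0 j i
  obtain ⟨⟨t, p⟩, hK, hmax⟩ := hKc.exists_isMaxOn hKn continuous_fst.continuousOn
  obtain ⟨⟨⟨ht, -⟩, hp⟩, hle⟩ := hK
  simp only at ht hp hle
  have hp0 : p ≠ 0 := by
    rintro rfl
    simpa using hp.2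
  set q := (M ^ m) *ᵥ p with hq
  have hqpos : ∀ i, 0 < q i := mulVec_pos_of_pos hm hp.1 hp0
  -- A nonzero slack `M p - t p ≥ 0` becomes strictly positive under `M ^ m`, so `q` admits a value
  -- larger than `t`.
  have heig : M *ᵥ p = t • p := by
    by_contra hne
    have hpos : ∀ i, 0 < ((M ^ m) *ᵥ (M *ᵥ p - t • p)) i :=
      mulVec_pos_of_pos hm (fun i => by simpa using hle i) (sub_ne_zero.mpr hne)
    have heq : (M ^ m) *ᵥ (M *ᵥ p - t • p) = M *ᵥ q - t • q := by
      rw [mulVec_sub, mulVec_smul, mulVec_mulVec, hq, mulVec_mulVec, ← pow_succ, ← pow_succ']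
    rw [heq] at hpos
    obtain ⟨i₀, -, hi₀⟩ := Finset.exists_min_image Finset.univ
      (fun i => (M *ᵥ q - t • q) i / q i) Finset.univ_nonempty
    set e := (M *ᵥ q - t • q) i₀ / q i₀ with he
    have hepos : 0 < e := div_pos (hpos i₀) (hqpos i₀)
    have hs : 0 < ∑ i, q i := Finset.sum_pos (fun i _ => hqpos i) Finset.univ_nonempty
    have hin : (t + e, (∑ i, q i)⁻¹ • q) ∈ K := by
      refine hmem _ _ (by positivity) ⟨fun i => ?_, ?_⟩ fun i => ?_
      · have := hqpos i
        simp only [Pi.smul_apply, smul_eq_mul]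
        positivity
      · simp only [Pi.smul_apply, smul_eq_mul, ← Finset.mul_sum]
        exact inv_mul_cancel₀ hs.ne'
      · rw [mulVec_smul]
        simp only [Pi.smul_apply, smul_eq_mul]
        have h1 := hi₀ i (Finset.mem_univ i)
        rw [le_div_iff₀ (hqpos i)] at h1
        simp only [Pi.sub_apply, Pi.smul_apply, smul_eq_mul] at h1
        have h2 : (t + e) * q i ≤ (M *ᵥ q) i := by linarith
        calc (t + e) * ((∑ i, q i)⁻¹ * q i) = (∑ i, q i)⁻¹ * ((t + e) * q i) := by ring
          _ ≤ _ := mul_le_mul_of_nonneg_left h2 (inv_nonneg.mpr hs.le)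
    have := hmax hin
    simp only [Set.mem_ofPred_eq] at this
    linarith
  refine ⟨t, p, fun i => ?_, hp.2, heig⟩
  have h := hqpos i
  rw [hq, pow_mulVec_eigen heig] at h
  exact pos_of_mul_pos_right h (pow_nonneg ht m)

/-- Simplicity of the Perron–Frobenius eigenvalue of a primitive matrix. -/
theorem exists_eq_smul_of_eigen [DecidableEq n] [Nonempty n] {M : Matrix n n ℝ} (hM : M.IsPrimitive)
    {t : ℝ} {x v : n → ℝ} (hx : ∀ i, 0 < x i) (hxe : M *ᵥ x = t • x) (hve : M *ᵥ v = t • v) :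
    ∃ c : ℝ, v = c • x := by
  obtain ⟨-, m, -, hm⟩ := hM
  -- The largest multiple of `x` below `v` leaves a nonnegative eigenvector vanishing at `i₀`; `M ^
  -- m` would make it positive there unless it is zero.
  obtain ⟨i₀, -, hi₀⟩ := Finset.exists_min_image Finset.univ
    (fun i => v i / x i) Finset.univ_nonempty
  refine ⟨v i₀ / x i₀, ?_⟩
  by_contra hne
  have hu : ∀ i, 0 ≤ (v - (v i₀ / x i₀) • x) i := fun i => by
    have := hi₀ i (Finset.mem_univ i)
    rw [le_div_iff₀ (hx i)] at this
    simpa using this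
  have hpos := mulVec_pos_of_pos hm hu (sub_ne_zero.mpr hne) i₀
  have he : M *ᵥ (v - (v i₀ / x i₀) • x) = t • (v - (v i₀ / x i₀) • x) := by
    rw [mulVec_sub, mulVec_smul, hxe, hve, smul_sub, smul_comm]
  rw [pow_mulVec_eigen he] at hpos
  simp [div_mul_cancel₀ _ (hx i₀).ne'] at hpos

/-- A nonnegative matrix with a positive eigenvector has the corresponding eigenvalue
as its spectral radius. -/
theorem spectralRadius_eq_of_pos_eigenvector [DecidableEq n] [Nonempty n] {M : Matrix n n ℝ}
    (h0 : ∀ i j, 0 ≤ M i j) {t : ℝ} {x : n → ℝ} (hx : ∀ i, 0 < x i) (hxe : M *ᵥ x = t • x) :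
    (spectralRadius ℂ (M.map (fun r : ℝ => (r : ℂ)))).toReal = t := by
  have hmem : ∀ z : ℂ, z ∈ spectrum ℂ (M.map (fun r : ℝ => (r : ℂ))) ↔
      ∃ v : n → ℂ, v ≠ 0 ∧ (M.map (fun r : ℝ => (r : ℂ))) *ᵥ v = z • v := by
    intro z
    rw [spectrum.mem_iff, Matrix.isUnit_iff_isUnit_det, isUnit_iff_ne_zero, not_not,
      ← Matrix.exists_mulVec_eq_zero_iff]
    refine exists_congr fun v => and_congr_right fun _ => ?_
    rw [sub_mulVec, sub_eq_zero, Algebra.algebraMap_eq_smul_one, smul_mulVec, one_mulVec, eq_comm]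
  obtain ⟨i₁⟩ := ‹Nonempty n›
  have ht : 0 ≤ t := by
    have h1 : (M *ᵥ x) i₁ = t * x i₁ := by rw [hxe]; rfl
    have h2 : 0 ≤ (M *ᵥ x) i₁ := Finset.sum_nonneg fun j _ => mul_nonneg (h0 _ _) (hx j).le
    exact nonneg_of_mul_nonneg_left (h1 ▸ h2) (hx i₁)
  have htm : (t : ℂ) ∈ spectrum ℂ (M.map (fun r : ℝ => (r : ℂ))) := by
    rw [hmem]
    refine ⟨fun i => (x i : ℂ), fun h => ?_, ?_⟩
    · have := congrFun h i₁
      simp only [Pi.zero_apply, Complex.ofReal_eq_zero] at this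
      exact (hx i₁).ne' this
    · ext i
      have h1 : (M *ᵥ x) i = t * x i := by rw [hxe]; rfl
      simp only [mulVec, dotProduct, map_apply, Pi.smul_apply, smul_eq_mul] at h1 ⊢
      exact_mod_cast congrArg (fun r : ℝ => (r : ℂ)) h1
  have hle : ∀ z ∈ spectrum ℂ (M.map (fun r : ℝ => (r : ℂ))), ‖z‖ ≤ t := by
    intro z hz
    obtain ⟨v, hv0, hv⟩ := (hmem z).mp hz
    -- In the weighted norm `max ‖v i‖ / x i` the matrix has operator norm at most `t`.
    obtain ⟨i₀, -, hi₀⟩ := Finset.exists_max_image Finset.univ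
      (fun i => ‖v i‖ / x i) ⟨i₁, Finset.mem_univ _⟩
    set c := ‖v i₀‖ / x i₀ with hc
    have hvc : ∀ i, ‖v i‖ ≤ c * x i := fun i => (div_le_iff₀ (hx i)).mp (hi₀ i (Finset.mem_univ i))
    have hcpos : 0 < c := by
      obtain ⟨j, hj⟩ := Function.ne_iff.mp hv0
      have : 0 < ‖v j‖ := norm_pos_iff.mpr hj
      exact pos_of_mul_pos_left (this.trans_le (hvc j)) (hx j).le
    have hi : ‖v i₀‖ = c * x i₀ := by rw [hc, div_mul_cancel₀ _ (hx i₀).ne']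
    have key : ‖z‖ * (c * x i₀) ≤ t * (c * x i₀) := by
      calc ‖z‖ * (c * x i₀) = ‖(z • v) i₀‖ := by rw [← hi, Pi.smul_apply, smul_eq_mul, norm_mul]
        _ = ‖∑ j, (M i₀ j : ℂ) * v j‖ := by rw [← hv]; rfl
        _ ≤ ∑ j, M i₀ j * (c * x j) := by
          refine norm_sum_le_of_le _ fun j _ => ?_
          rw [norm_mul, Complex.norm_real, Real.norm_of_nonneg (h0 _ _)]
          exact mul_le_mul_of_nonneg_left (hvc j) (h0 _ _)
        _ = c * (M *ᵥ x) i₀ := by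
          simp only [mulVec, dotProduct, Finset.mul_sum]
          exact Finset.sum_congr rfl fun j _ => by ring
        _ = t * (c * x i₀) := by rw [hxe, Pi.smul_apply, smul_eq_mul]; ring
    exact le_of_mul_le_mul_right key (mul_pos hcpos (hx i₀))
  have : spectralRadius ℂ (M.map (fun r : ℝ => (r : ℂ))) = ENNReal.ofReal t := by
    refine le_antisymm (iSup₂_le fun z hz => ?_) ?_
    · change ‖z‖ₑ ≤ _
      rw [← ofReal_norm]
      exact ENNReal.ofReal_le_ofReal (hle z hz)
    · refine le_trans (le_of_eq ?_) (le_iSup₂ (f := fun z (_ : z ∈ spectrum ℂ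
        (M.map (fun r : ℝ => (r : ℂ)))) => ‖z‖ₑ) (t : ℂ) htm)
      rw [← ofReal_norm, Complex.norm_real, Real.norm_of_nonneg ht]
  rw [this, ENNReal.toReal_ofReal ht]

/-- For a positive matrix with positive eigenvector `x`, each functional positive on `x` becomes
entrywise positive after sufficiently many applications of the matrix. -/
theorem eventually_vecMul_pow_pos [DecidableEq n] [Nonempty n] {B : Matrix n n ℝ} (hB : ∀ i j, 0 < B i j)
    {t : ℝ} {x : n → ℝ} (hx : ∀ i, 0 < x i) (hxe : B *ᵥ x = t • x)
    (h : n → ℝ) (hh : 0 < h ⬝ᵥ x) (j : n) :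
    ∀ᶠ N in Filter.atTop, 0 < (h ᵥ* (B ^ N)) j := by
  -- Here `B` dominates the rank-one matrix `e x 1ᵀ`. The difference is nonnegative and has
  -- eigenvalue `r < t` at `x`, which is the spectral gap.
  obtain ⟨⟨i₀, j₀⟩, -, hmin⟩ := Finset.exists_min_image (Finset.univ : Finset (n × n))
    (fun q => B q.1 q.2 / x q.1) Finset.univ_nonempty
  set e := B i₀ j₀ / x i₀ with he
  have hepos : 0 < e := div_pos (hB _ _) (hx _)
  have heB : ∀ i k, e * x i ≤ B i k := fun i k =>
    (le_div_iff₀ (hx i)).mp (hmin (i, k) (Finset.mem_univ _))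
  set r := t - e * ∑ i, x i with hr
  have hsum : 0 < ∑ i, x i := Finset.sum_pos (fun i _ => hx i) Finset.univ_nonempty
  have hBx : ∀ i, ∑ k, B i k * x k = t * x i := fun i => congrFun hxe i
  have hEx : ∀ i, ∑ k, (B i k - e * x i) * x k = r * x i := fun i => by
    simp only [sub_mul, Finset.sum_sub_distrib, hBx, ← Finset.mul_sum, hr]
    ring
  have hr0 : 0 ≤ r := by
    have : 0 ≤ r * x i₀ := hEx i₀ ▸ Finset.sum_nonneg fun k _ =>
      mul_nonneg (sub_nonneg.mpr (heB _ _)) (hx k).le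
    exact nonneg_of_mul_nonneg_left this (hx i₀)
  have ht : 0 < t := by nlinarith [mul_pos hepos hsum]
  -- `B ^ (N + 1)` applied to the `j`-th unit vector splits as a multiple of `x` and a small rest.
  have hdec : ∀ N : ℕ, ∃ c : ℝ, e * t ^ N ≤ c ∧ ∀ i, 0 ≤ (B ^ (N + 1)) i j - c * x i ∧
      (B ^ (N + 1)) i j - c * x i ≤ r ^ N * (t / x j) * x i := by
    intro N
    induction N with
    | zero =>
      refine ⟨e, by simp, fun i => ⟨?_, ?_⟩⟩
      · simpa using heB i j
      · have h1 : B i j * x j ≤ t * x i := by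
          rw [← hBx i]
          exact Finset.single_le_sum (f := fun k => B i k * x k)
            (fun k _ => mul_nonneg (hB i k).le (hx k).le) (Finset.mem_univ j)
        have h2 : B i j ≤ t / x j * x i := by
          rw [div_mul_eq_mul_div, le_div_iff₀ (hx j)]
          exact h1
        have := mul_pos hepos (hx i)
        simp only [zero_add, pow_one, pow_zero, one_mul]
        linarith
    | succ N ih =>
      obtain ⟨c, hc, hu⟩ := ih
      set u : n → ℝ := fun i => (B ^ (N + 1)) i j - c * x i with hudef
      have hstep : ∀ i, (B ^ (N + 1 + 1)) i j - (c * t + e * ∑ k, u k) * x i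
          = ∑ k, (B i k - e * x i) * u k := by
        intro i
        have h1 : (B ^ (N + 1 + 1)) i j = ∑ k, B i k * u k + c * (t * x i) := by
          rw [pow_succ', mul_apply, ← hBx i, Finset.mul_sum, ← Finset.sum_add_distrib]
          exact Finset.sum_congr rfl fun k _ => by simp only [hudef]; ring
        rw [h1]
        simp only [sub_mul, Finset.sum_sub_distrib, ← Finset.mul_sum]
        ring
      refine ⟨c * t + e * ∑ k, u k, ?_, fun i => ?_⟩
      · have h1 : 0 ≤ ∑ k, u k := Finset.sum_nonneg fun k _ => (hu k).1
        have h2 := mul_le_mul_of_nonneg_right hc ht.le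
        rw [pow_succ]
        nlinarith [mul_nonneg hepos.le h1]
      · rw [hstep]
        refine ⟨Finset.sum_nonneg fun k _ => mul_nonneg (sub_nonneg.mpr (heB _ _)) (hu k).1, ?_⟩
        calc ∑ k, (B i k - e * x i) * u k
            ≤ ∑ k, (B i k - e * x i) * (r ^ N * (t / x j) * x k) :=
              Finset.sum_le_sum fun k _ =>
                mul_le_mul_of_nonneg_left (hu k).2 (sub_nonneg.mpr (heB _ _))
          _ = r ^ N * (t / x j) * ∑ k, (B i k - e * x i) * x k := by
              rw [Finset.mul_sum]
              exact Finset.sum_congr rfl fun k _ => by ring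
          _ = r ^ (N + 1) * (t / x j) * x i := by rw [hEx, pow_succ]; ring
  set D := (t / x j) * ∑ i, |h i| * x i with hD
  have hlow : ∀ N : ℕ, e * t ^ N * (h ⬝ᵥ x) - r ^ N * D ≤ (h ᵥ* (B ^ (N + 1))) j := by
    intro N
    obtain ⟨c, hc, hu⟩ := hdec N
    have h1 : (h ᵥ* (B ^ (N + 1))) j
        = c * (h ⬝ᵥ x) + ∑ i, h i * ((B ^ (N + 1)) i j - c * x i) := by
      simp only [vecMul, dotProduct, Finset.mul_sum, ← Finset.sum_add_distrib]
      exact Finset.sum_congr rfl fun k _ => by ring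
    have h2 : -(r ^ N * D) ≤ ∑ i, h i * ((B ^ (N + 1)) i j - c * x i) := by
      rw [hD, ← mul_assoc, Finset.mul_sum, ← Finset.sum_neg_distrib]
      refine Finset.sum_le_sum fun i _ => ?_
      have h3 := mul_le_mul_of_nonneg_left (hu i).2 (abs_nonneg (h i))
      have h4 := mul_le_mul_of_nonneg_right (neg_abs_le (h i)) (hu i).1
      nlinarith
    rw [h1]
    nlinarith [mul_le_mul_of_nonneg_right hc hh.le]
  have hlim : Filter.Tendsto (fun N : ℕ => (r / t) ^ N * D) Filter.atTop (nhds (0 * D)) := by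
    refine (tendsto_pow_atTop_nhds_zero_of_lt_one (by positivity) ?_).mul_const D
    rw [div_lt_one ht]
    nlinarith [mul_pos hepos hsum]
  rw [zero_mul] at hlim
  have hev : ∀ᶠ N : ℕ in Filter.atTop, 0 < (h ᵥ* (B ^ (N + 1))) j := by
    filter_upwards [hlim.eventually_lt_const (mul_pos hepos hh)] with N hN
    refine lt_of_lt_of_le ?_ (hlow N)
    have h5 : r ^ N * D = t ^ N * ((r / t) ^ N * D) := by
      rw [div_pow]
      field_simp
    rw [h5]
    have := mul_lt_mul_of_pos_left hN (pow_pos ht N)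
    nlinarith
  obtain ⟨N₀, hN₀⟩ := Filter.eventually_atTop.mp hev
  refine Filter.eventually_atTop.mpr ⟨N₀ + 1, fun N hN => ?_⟩
  obtain ⟨K, rfl⟩ : ∃ K, N = K + 1 := ⟨N - 1, by omega⟩
  exact hN₀ K (by omega)

end Perron

/-! ### Positive bases of finitely generated subgroups of `ℝ`. -/

section Elliott

variable {ι : Type*}

/-- Replacing a member `z i` of a family by `z i - z j` does not change the generated subgroup,
and enlarges the generated submonoid. -/
theorem update_sub_mem [DecidableEq ι] (z : ι → ℝ) {i j : ι} (hij : i ≠ j) :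
    (∀ l, z l ∈ AddSubmonoid.closure (Set.range (Function.update z i (z i - z j)))) ∧
    (∀ l, Function.update z i (z i - z j) l ∈ AddSubgroup.closure (Set.range z)) := by
  have hz : ∀ l, z l ∈ AddSubgroup.closure (Set.range z) :=
    fun l => AddSubgroup.subset_closure ⟨l, rfl⟩
  refine ⟨fun l => ?_, fun l => ?_⟩
  · have h : ∀ l, Function.update z i (z i - z j) l ∈
        AddSubmonoid.closure (Set.range (Function.update z i (z i - z j))) :=
      fun l => AddSubmonoid.subset_closure ⟨l, rfl⟩
    rcases eq_or_ne l i with rfl | hl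
    · have h1 := add_mem (h l) (h j)
      rwa [Function.update_self, Function.update_of_ne hij.symm, sub_add_cancel] at h1
    · simpa [Function.update_of_ne hl] using h l
  · rcases eq_or_ne l i with rfl | hl
    · rw [Function.update_self]
      exact sub_mem (hz l) (hz j)
    · rw [Function.update_of_ne hl]
      exact hz l

/-- A Euclidean step carries the relation along: `a i * z i + a j * z j = a i * (z i - z j) + (a j +
a i) * z j`. -/
theorem sum_update_relation [Fintype ι] [DecidableEq ι] (z : ι → ℝ) (a : ι → ℤ) {i j : ι}
    (hij : i ≠ j) :
    ∑ l, (Function.update a j (a j + a i) l : ℝ) * Function.update z i (z i - z j) l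
      = ∑ l, (a l : ℝ) * z l := by
  rw [← sub_eq_zero, ← Finset.sum_sub_distrib]
  rw [Finset.sum_eq_add_of_mem i j (Finset.mem_univ _) (Finset.mem_univ _) hij]
  · simp only [Function.update_self, Function.update_of_ne hij, Function.update_of_ne hij.symm]
    push_cast
    ring
  · intro l _ hl
    simp [Function.update_of_ne hl.1, Function.update_of_ne hl.2]

/-- A family of `n + 1` positive reals satisfying a nontrivial integral relation is contained in
the submonoid generated by `n` positive elements of the subgroup it generates. -/
theorem exists_shorter_family {n : ℕ} (z : Fin (n + 1) → ℝ) (hz : ∀ i, 0 < z i)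
    (a : Fin (n + 1) → ℤ) (ha : a ≠ 0) (hrel : ∑ l, (a l : ℝ) * z l = 0) :
    ∃ y : Fin n → ℝ, (∀ i, 0 < y i) ∧ (∀ i, z i ∈ AddSubmonoid.closure (Set.range y)) ∧
      ∀ i, y i ∈ AddSubgroup.closure (Set.range z) := by
  -- Induction on the maximum of `|a l|`, its multiplicity and the number of negative `a l`.
  suffices key : ∀ (μ : ℕ ×ₗ ℕ ×ₗ ℕ) (z : Fin (n + 1) → ℝ) (a : Fin (n + 1) → ℤ) (j : Fin (n + 1)),
      (∀ i, 0 < z i) → 0 < a j → (∀ l, |a l| ≤ a j) → ∑ l, (a l : ℝ) * z l = 0 →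
      toLex ((a j).natAbs, toLex ((Finset.univ.filter fun l => |a l| = a j).card,
        (Finset.univ.filter fun l => a l < 0).card)) = μ →
      ∃ y : Fin n → ℝ, (∀ i, 0 < y i) ∧ (∀ i, z i ∈ AddSubmonoid.closure (Set.range y)) ∧
        ∀ i, y i ∈ AddSubgroup.closure (Set.range z) by
    obtain ⟨j, -, hj⟩ := Finset.exists_max_image Finset.univ (fun l => |a l|) Finset.univ_nonempty
    have hj0 : a j ≠ 0 := fun h => ha <| funext fun l => by
      have := hj l (Finset.mem_univ l)
      rw [h, abs_zero] at this
      exact abs_nonpos_iff.mp this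
    rcases lt_or_gt_of_ne hj0 with h | h
    · refine key _ z (-a) j hz (by simpa using h) (fun l => ?_) ?_ rfl
      · have := hj l (Finset.mem_univ l)
        rw [abs_of_neg h] at this
        simpa using this
      · simpa using hrel
    · refine key _ z a j hz h (fun l => ?_) hrel rfl
      have := hj l (Finset.mem_univ l)
      rwa [abs_of_pos h] at this
  intro μ
  induction μ using WellFoundedLT.induction with
  | ind μ ih =>
  intro z a j hz hj hmax hrel hμ
  obtain ⟨i, hi⟩ : ∃ i, a i < 0 := by
    by_contra! hcon
    have : 0 < ∑ l, (a l : ℝ) * z l :=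
      Finset.sum_pos' (fun l _ => mul_nonneg (by exact_mod_cast hcon l) (hz l).le)
        ⟨j, Finset.mem_univ j, mul_pos (by exact_mod_cast hj) (hz j)⟩
    exact this.ne' hrel
  have hij : i ≠ j := by
    rintro rfl
    exact lt_asymm hi hj
  have hile : -a i ≤ a j := by simpa [abs_of_neg hi] using hmax i
  -- The conclusion passes from an updated family to the original one.
  have transfer : ∀ {u v : Fin (n + 1)}, u ≠ v →
      (∃ y : Fin n → ℝ, (∀ l, 0 < y l) ∧
        (∀ l, Function.update z u (z u - z v) l ∈ AddSubmonoid.closure (Set.range y)) ∧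
        ∀ l, y l ∈ AddSubgroup.closure (Set.range (Function.update z u (z u - z v)))) →
      ∃ y : Fin n → ℝ, (∀ l, 0 < y l) ∧ (∀ l, z l ∈ AddSubmonoid.closure (Set.range y)) ∧
        ∀ l, y l ∈ AddSubgroup.closure (Set.range z) := by
    rintro u v h ⟨y, hy, h1, h2⟩
    obtain ⟨h3, h4⟩ := update_sub_mem z h
    refine ⟨y, hy, fun l => ?_, fun l => ?_⟩
    · exact (AddSubmonoid.closure_le.mpr (Set.range_subset_iff.mpr h1)) (h3 l)
    · exact ((AddSubgroup.closure_le _).mpr (Set.range_subset_iff.mpr h4)) (h2 l)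
  have update_pos : ∀ {u v : Fin (n + 1)}, z v < z u →
      ∀ l, 0 < Function.update z u (z u - z v) l := by
    intro u v h l
    rcases eq_or_ne l u with rfl | hl
    · simpa using h
    · rw [Function.update_of_ne hl]
      exact hz l
  rcases lt_trichotomy (z i) (z j) with h | h | h
  -- Subtracting `z i` from `z j` turns `a i < 0` into `a i + a j ∈ [0, a j)`: the maximum stays,
  -- its multiplicity does not grow, and one negative coefficient disappears.
  · refine transfer hij.symm (ih _ ?_ _ (Function.update a i (a i + a j)) j (update_pos h) ?_ ?_
      ((sum_update_relation z a hij.symm).trans hrel) rfl)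
    · rw [← hμ, Function.update_of_ne hij.symm]
      refine Prod.Lex.toLex_lt_toLex.mpr (Or.inr ⟨rfl, ?_⟩)
      have hsub : (Finset.univ.filter fun l => |Function.update a i (a i + a j) l| = a j) ⊆
          Finset.univ.filter fun l => |a l| = a j := by
        intro l hl
        simp only [Finset.mem_filter, Finset.mem_univ, true_and] at hl ⊢
        rcases eq_or_ne l i with rfl | hne
        · rw [Function.update_self, abs_of_nonneg (by omega)] at hl
          omega
        · rwa [Function.update_of_ne hne] at hl
      have hneg : (Finset.univ.filter fun l => Function.update a i (a i + a j) l < 0).card <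
          (Finset.univ.filter fun l => a l < 0).card := by
        refine Finset.card_lt_card (Finset.ssubset_iff_of_subset ?_ |>.mpr ⟨i, ?_, ?_⟩)
        · intro l hl
          simp only [Finset.mem_filter, Finset.mem_univ, true_and] at hl ⊢
          rcases eq_or_ne l i with rfl | hne
          · exact hi
          · rwa [Function.update_of_ne hne] at hl
        · simpa using hi
        · simp only [Finset.mem_filter, Finset.mem_univ, true_and, Function.update_self]
          omega
      exact Prod.Lex.toLex_lt_toLex.mpr
        ((Finset.card_le_card hsub).lt_or_eq.imp_right fun h => ⟨h, hneg⟩)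
    · rwa [Function.update_of_ne hij.symm]
    · intro l
      rw [Function.update_of_ne hij.symm]
      rcases eq_or_ne l i with rfl | hne
      · rw [Function.update_self, abs_of_nonneg (by omega)]
        omega
      · rw [Function.update_of_ne hne]
        exact hmax l
  -- Equal members: `z i` is redundant, which is where the family gets shorter.
  · refine ⟨z ∘ i.succAbove, fun l => hz _, fun l => ?_, fun l =>
      AddSubgroup.subset_closure ⟨_, rfl⟩⟩
    have hne : ∀ l, l ≠ i → z l ∈ AddSubmonoid.closure (Set.range (z ∘ i.succAbove)) := by
      intro l hl
      obtain ⟨m, rfl⟩ := Fin.exists_succAbove_eq hl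
      exact AddSubmonoid.subset_closure ⟨m, rfl⟩
    rcases eq_or_ne l i with rfl | hl
    · rw [h]
      exact hne j hij.symm
    · exact hne l hl
  -- Now `a j` drops into `[0, a j)`, so the maximum or its multiplicity falls, whatever happens to
  -- the signs. The untouched `a i < 0` keeps the relation nontrivial.
  · set b := Function.update a j (a j + a i) with hb
    have hbj : b j = a j + a i := Function.update_self ..
    have hbl : ∀ l, l ≠ j → b l = a l := fun l hl => Function.update_of_ne hl ..
    have hrel' := (sum_update_relation z a hij).trans hrel
    have hle' : ∀ l, |b l| ≤ a j := by
      intro l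
      rcases eq_or_ne l j with rfl | hl
      · rw [hbj, abs_of_nonneg (by omega)]
        omega
      · rw [hbl l hl]
        exact hmax l
    obtain ⟨p, -, hp⟩ := Finset.exists_max_image Finset.univ (fun l => |b l|)
      Finset.univ_nonempty
    have hp0 : 0 < |b p| := by
      have h1 := hp i (Finset.mem_univ i)
      rw [hbl i hij, abs_of_neg hi] at h1
      omega
    -- Up to sign, the new relation has smaller measure.
    have hlt : ∀ c : ℕ, toLex (b p |>.natAbs, toLex
        ((Finset.univ.filter fun l => |b l| = |b p|).card, c)) < μ := by
      intro c
      rw [← hμ]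
      refine Prod.Lex.toLex_lt_toLex.mpr ?_
      rcases (hle' p).lt_or_eq with h1 | h1
      · left
        rw [Int.abs_eq_natAbs] at h1
        simp only
        omega
      · have h2 : (b p).natAbs = (a j).natAbs := by
          rw [Int.abs_eq_natAbs] at h1
          omega
        refine Or.inr ⟨h2, Prod.Lex.toLex_lt_toLex.mpr (Or.inl ?_)⟩
        simp only [h1]
        refine Finset.card_lt_card (Finset.ssubset_iff_of_subset ?_ |>.mpr ⟨j, ?_, ?_⟩)
        · intro l hl
          simp only [Finset.mem_filter, Finset.mem_univ, true_and] at hl ⊢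
          rcases eq_or_ne l j with rfl | hne
          · exact abs_of_pos hj
          · rwa [hbl l hne] at hl
        · simpa using hj.le
        · simp only [Finset.mem_filter, Finset.mem_univ, true_and, hbj]
          rw [abs_of_nonneg (by omega)]
          omega
    refine transfer hij ?_
    rcases lt_or_gt_of_ne (abs_pos.mp hp0) with h1 | h1
    · refine ih _ (hlt (Finset.univ.filter fun l => (-b) l < 0).card) _ (-b) p (update_pos h)
        (by simpa using h1) (fun l => ?_) ?_ ?_
      · simpa [abs_of_neg h1] using hp l (Finset.mem_univ l)
      · simpa using hrel'
      · simp [abs_of_neg h1]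
    · refine ih _ (hlt (Finset.univ.filter fun l => b l < 0).card) _ b p (update_pos h)
        h1 (fun l => ?_) hrel' ?_
      · simpa [abs_of_pos h1] using hp l (Finset.mem_univ l)
      · simp [abs_of_pos h1]

/-- A finitely generated subgroup of `ℝ` with positive generators has a positive basis
generating a submonoid that contains the given generators. -/
theorem exists_pos_basis {n : ℕ} (z : Fin n → ℝ) (hz : ∀ i, 0 < z i) :
    ∃ (m : ℕ) (y : Fin m → ℝ), (∀ i, 0 < y i) ∧ LinearIndependent ℤ y ∧
      (∀ i, z i ∈ AddSubmonoid.closure (Set.range y)) ∧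
      ∀ i, y i ∈ AddSubgroup.closure (Set.range z) := by
  induction n with
  | zero => exact ⟨0, z, hz, linearIndependent_empty_type, fun i => i.elim0, fun i => i.elim0⟩
  | succ n ih =>
    by_cases hli : LinearIndependent ℤ z
    · exact ⟨n + 1, z, hz, hli, fun i => AddSubmonoid.subset_closure ⟨i, rfl⟩,
        fun i => AddSubgroup.subset_closure ⟨i, rfl⟩⟩
    obtain ⟨a, hrel, i, hi⟩ := Fintype.not_linearIndependent_iff.mp hli
    obtain ⟨z', hz', h1, h2⟩ := exists_shorter_family z hz a (fun h => hi (by simp [h]))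
      (by simpa using hrel)
    obtain ⟨m, y, hy, hyl, h3, h4⟩ := ih z' hz'
    exact ⟨m, y, hy, hyl,
      fun i => AddSubmonoid.closure_le.mpr (Set.range_subset_iff.mpr h3) (h1 i),
      fun i => (AddSubgroup.closure_le _).mpr (Set.range_subset_iff.mpr h2) (h4 i)⟩

end Elliott

/-! ### Perron vectors, the group `H x` and the set `S A`. -/

section PerronVector

open Matrix

variable {s : ℕ} {A : Matrix (Fin s) (Fin s) ℕ} {x : Fin s → ℝ}

theorem perronRoot_eq_of_pos_eigenvector [Nonempty (Fin s)] {t : ℝ} (hx : ∀ i, 0 < x i)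
    (hxe : (A.map (fun n : ℕ => (n : ℝ))) *ᵥ x = t • x) : perronRoot A = t := by
  rw [← spectralRadius_eq_of_pos_eigenvector (fun i j => by simp) hx hxe, perronRoot]
  congr 2

theorem Primitive.exists_isNormalizedPerronVector [Nonempty (Fin s)] (hA : Primitive A) :
    ∃ x, IsNormalizedPerronVector A x := by
  obtain ⟨t, x, hx, hs, he⟩ := exists_pos_eigenvector hA
  exact ⟨x, hx, by rw [perronRoot_eq_of_pos_eigenvector hx he]; exact he, hs⟩

theorem IsNormalizedPerronVector.nonempty (hx : IsNormalizedPerronVector A x) :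
    Nonempty (Fin s) := by
  by_contra h
  rw [not_nonempty_iff] at h
  simpa using hx.sum_eq_one

theorem IsNormalizedPerronVector.unique (hA : Primitive A) {y : Fin s → ℝ}
    (hx : IsNormalizedPerronVector A x) (hy : IsNormalizedPerronVector A y) : y = x := by
  have := hx.nonempty
  obtain ⟨c, rfl⟩ := exists_eq_smul_of_eigen hA hx.pos hx.eigen hy.eigen
  have h := hy.sum_eq_one
  simp only [Pi.smul_apply, smul_eq_mul, ← Finset.mul_sum, hx.sum_eq_one, mul_one] at h
  rw [h, one_smul]

theorem IsNormalizedPerronVector.perronRoot_pos (hA : Primitive A)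
    (hx : IsNormalizedPerronVector A x) : 0 < perronRoot A := by
  obtain ⟨i⟩ := hx.nonempty
  obtain ⟨-, m, hm, hpos⟩ := hA
  have h1 := mulVec_pos_of_pos hpos (fun j => (hx.pos j).le)
    (fun h => (hx.pos i).ne' (congrFun h i)) i
  rw [pow_mulVec_eigen hx.eigen] at h1
  refine lt_of_le_of_ne ENNReal.toReal_nonneg fun h => ?_
  rw [← h, zero_pow hm.ne'] at h1
  simp at h1

theorem IsNormalizedPerronVector.mem_S_iff (hA : Primitive A)
    (hx : IsNormalizedPerronVector A x) (u : ℝ) :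
    u ∈ S A ↔ ∃ N : ℕ, perronRoot A ^ N * u ∈ H x := by
  have hpos := hx.perronRoot_pos hA
  simp only [S, Set.mem_iUnion]
  constructor
  · rintro ⟨y, hy, N, v, hv, rfl⟩
    obtain rfl := hx.unique hA hy
    refine ⟨N, ?_⟩
    have : perronRoot A ^ N * ((1 / perronRoot A ^ N) • v) = v := by
      rw [smul_eq_mul]
      field_simp
    change perronRoot A ^ N * ((1 / perronRoot A ^ N) • v) ∈ H _
    rwa [this]
  · rintro ⟨N, hN⟩
    refine ⟨x, hx, N, _, hN, ?_⟩
    simp only [smul_eq_mul]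
    field_simp

theorem mem_H (x : Fin s → ℝ) (i : Fin s) : x i ∈ H x := AddSubgroup.subset_closure ⟨i, rfl⟩

/-- The eigenvector equation expresses `λ x i` as an integer combination of the coordinates; hence
the groups `λ^{-N} H x` increase with `N`. -/
theorem IsNormalizedPerronVector.pow_mul_mem_H (hx : IsNormalizedPerronVector A x) {u : ℝ}
    (hu : u ∈ H x) (N : ℕ) : perronRoot A ^ N * u ∈ H x := by
  induction N with
  | zero => simpa using hu
  | succ N ih =>
    rw [pow_succ', mul_assoc]
    generalize perronRoot A ^ N * u = v at ih
    have hle : H x ≤ (H x).comap (AddMonoidHom.mulLeft (perronRoot A)) := by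
      refine (AddSubgroup.closure_le _).mpr ?_
      rintro _ ⟨i, rfl⟩
      have h1 := congrFun hx.eigen i
      simp only [mulVec, dotProduct, map_apply, Pi.smul_apply, smul_eq_mul] at h1
      simp only [AddSubgroup.coe_comap, Set.mem_preimage, AddMonoidHom.coe_mulLeft, ← h1]
      refine sum_mem fun j _ => ?_
      rw [← nsmul_eq_mul]
      exact nsmul_mem (mem_H x j) _
    exact hle ih

theorem mem_H_smul_iff {c : ℝ} (hc : c ≠ 0) (y : Fin s → ℝ) (u : ℝ) :
    u ∈ H (c • y) ↔ c⁻¹ * u ∈ H y := by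
  have h : H (c • y) = (H y).map (AddMonoidHom.mulLeft c) := by
    rw [H, H, AddMonoidHom.map_closure, ← Set.range_comp]
    rfl
  rw [h, AddSubgroup.mem_map]
  constructor
  · rintro ⟨v, hv, rfl⟩
    simpa [hc] using hv
  · intro hu
    exact ⟨_, hu, by simp [hc]⟩

/-- The normalized Perron–Frobenius eigenvector has coordinates in the field generated by the
Perron–Frobenius eigenvalue. -/
theorem IsNormalizedPerronVector.mem_adjoin (hA : Primitive A)
    (hx : IsNormalizedPerronVector A x) (i : Fin s) :
    x i ∈ IntermediateField.adjoin ℚ {perronRoot A} := by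
  have := hx.nonempty
  let K := IntermediateField.adjoin ℚ {perronRoot A}
  let t : K := ⟨perronRoot A, IntermediateField.mem_adjoin_simple_self ℚ _⟩
  let D : Matrix (Fin s) (Fin s) K := A.map (fun n : ℕ => (n : K)) - t • (1 : Matrix _ _ K)
  have hD : D.map (algebraMap K ℝ) =
      A.map (fun n : ℕ => (n : ℝ)) - perronRoot A • (1 : Matrix _ _ ℝ) := by
    ext a b
    have : algebraMap K ℝ t = perronRoot A := rfl
    rcases eq_or_ne a b with rfl | hab
    · simp [D, ← this]
    · simp [D, hab]
  -- Singularity over `ℝ` descends to `K`, giving a kernel vector over `K`; by simplicity it is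
  -- proportional to `x`, and dividing by its coordinate sum recovers `x`.
  have hdet : D.det = 0 := by
    apply (algebraMap K ℝ).injective
    rw [RingHom.map_det, map_zero]
    refine Matrix.exists_mulVec_eq_zero_iff.mp ⟨x, fun h => (hx.pos i).ne' (congrFun h i), ?_⟩
    rw [RingHom.mapMatrix_apply, hD, sub_mulVec, hx.eigen, smul_mulVec, one_mulVec, sub_self]
  obtain ⟨v, hv0, hv⟩ := Matrix.exists_mulVec_eq_zero_iff.mpr hdet
  let w : Fin s → ℝ := algebraMap K ℝ ∘ v
  have hw : (A.map (fun n : ℕ => (n : ℝ))) *ᵥ w = perronRoot A • w := by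
    have h1 : D.map (algebraMap K ℝ) *ᵥ w = 0 := by
      ext a
      have := RingHom.map_mulVec (algebraMap K ℝ) D v a
      rw [hv] at this
      simpa using this.symm
    rwa [hD, sub_mulVec, smul_mulVec, one_mulVec, sub_eq_zero] at h1
  obtain ⟨c, hc⟩ := exists_eq_smul_of_eigen hA hx.pos hx.eigen hw
  have hsum : ∑ j, w j = c := by
    simp only [hc, Pi.smul_apply, smul_eq_mul, ← Finset.mul_sum, hx.sum_eq_one, mul_one]
  have hc0 : c ≠ 0 := by
    rintro rfl
    refine hv0 (funext fun j => ?_)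
    have := congrFun hc j
    simp only [zero_smul, Pi.zero_apply, w, Function.comp_apply] at this
    exact (map_eq_zero (algebraMap K ℝ)).mp this
  have hxi : x i = w i / ∑ j, w j := by
    rw [hsum, hc, Pi.smul_apply, smul_eq_mul, mul_div_cancel_left₀ _ hc0]
  rw [hxi]
  exact div_mem (v i).2 (sum_mem fun j _ => (v j).2)

theorem H_le_of_forall_mem {G : AddSubgroup ℝ} (h : ∀ i, x i ∈ G) : H x ≤ G :=
  (AddSubgroup.closure_le _).mpr (Set.range_subset_iff.mpr h)

theorem H_le_span (x : Fin s → ℝ) {u : ℝ} (hu : u ∈ H x) : u ∈ Submodule.span ℚ (Set.range x) :=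
  H_le_of_forall_mem (G := (Submodule.span ℚ (Set.range x)).toAddSubgroup)
    (fun i => Submodule.subset_span ⟨i, rfl⟩) hu

theorem card_le_of_linearIndependent_of_mem_span {k l : ℕ} {v : Fin k → ℝ} {w : Fin l → ℝ}
    (hv : LinearIndependent ℚ v) (h : ∀ i, v i ∈ Submodule.span ℚ (Set.range w)) : k ≤ l := by
  have h1 : LinearIndependent ℚ
      (fun i => (⟨v i, h i⟩ : Submodule.span ℚ (Set.range w))) :=
    LinearIndependent.of_comp (Submodule.span ℚ (Set.range w)).subtype hv
  have := FiniteDimensional.span_of_finite ℚ (Set.finite_range w)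
  simpa using h1.fintype_card_le_finrank.trans (finrank_range_le_card w)

theorem linearIndependent_mul {k : ℕ} {v : Fin k → ℝ} (hv : LinearIndependent ℚ v) {c : ℝ}
    (hc : c ≠ 0) : LinearIndependent ℚ (fun i => c * v i) :=
  hv.map' (LinearMap.mulLeft ℚ c) (LinearMap.ker_eq_bot.mpr (mul_right_injective₀ hc))

/-- If `S P` is a multiple of `S A`, then the size of `P` is at least the degree of the
Perron–Frobenius eigenvalue of `A`. -/
theorem natDegree_minpoly_le_of_S_eq (hA : Primitive A) [Nonempty (Fin s)] {l : ℕ}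
    {P : Matrix (Fin l) (Fin l) ℕ} (hP : Primitive P) {α : ℝ} (h : S P = α • S A) :
    (minpoly ℚ (perronRoot A)).natDegree ≤ l := by
  obtain ⟨x, hx⟩ := hA.exists_isNormalizedPerronVector
  obtain ⟨i₀⟩ := ‹Nonempty (Fin s)›
  have hmemA : ∀ j : ℕ, perronRoot A ^ j * x i₀ ∈ S A := fun j =>
    (hx.mem_S_iff hA _).mpr ⟨0, by simpa using hx.pow_mul_mem_H (mem_H x i₀) j⟩
  have hmemP : ∀ j : ℕ, α * (perronRoot A ^ j * x i₀) ∈ S P := fun j => by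
    rw [h]
    exact ⟨_, hmemA j, rfl⟩
  have hne : Nonempty (Fin l) := by
    have h0 := hmemP 0
    simp only [S, Set.mem_iUnion] at h0
    obtain ⟨y, hy, -⟩ := h0
    exact hy.nonempty
  obtain ⟨y, hy⟩ := hP.exists_isNormalizedPerronVector
  obtain ⟨j₀⟩ := hne
  have hα : α ≠ 0 := by
    rintro rfl
    have h1 : y j₀ ∈ S P := (hy.mem_S_iff hP _).mpr ⟨0, by simpa using mem_H y j₀⟩
    rw [h] at h1
    obtain ⟨v, -, hv⟩ := h1
    simp only [zero_smul] at hv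
    exact (hy.pos j₀).ne hv
  choose N hN using fun j => (hy.mem_S_iff hP _).mp (hmemP j)
  set k := (minpoly ℚ (perronRoot A)).natDegree
  -- A common exponent at least as large as every `N j` with `j < k`.
  set T := ∑ j : Fin k, N j
  have hli : LinearIndependent ℚ
      (fun j : Fin k => (perronRoot P ^ T * (α * x i₀)) * perronRoot A ^ (j : ℕ)) :=
    linearIndependent_mul (linearIndependent_pow (perronRoot A))
      (mul_ne_zero (pow_pos (hy.perronRoot_pos hP) T).ne' (mul_ne_zero hα (hx.pos i₀).ne'))
  refine card_le_of_linearIndependent_of_mem_span hli (w := y) fun j => H_le_span y ?_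
  have hle : N j ≤ T := Finset.single_le_sum (f := fun j : Fin k => N j)
    (fun _ _ => Nat.zero_le _) (Finset.mem_univ j)
  have h2 := hy.pow_mul_mem_H (hN j) (T - N j)
  rw [← mul_assoc, ← pow_add, Nat.sub_add_cancel hle] at h2
  convert h2 using 1
  ring

/-- A `ℤ`-independent family generating `H x` has as many members as the degree of the
Perron–Frobenius eigenvalue. -/
theorem IsNormalizedPerronVector.card_basis (hA : Primitive A)
    (hx : IsNormalizedPerronVector A x) (hint : IsIntegral ℚ (perronRoot A)) {m : ℕ}
    {y : Fin m → ℝ} (hy : LinearIndependent ℤ y) (hH : H y = H x) :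
    m = (minpoly ℚ (perronRoot A)).natDegree := by
  obtain ⟨i₀⟩ := hx.nonempty
  have hyQ : LinearIndependent ℚ y := (LinearIndependent.iff_fractionRing ℤ ℚ).mp hy
  apply le_antisymm
  · let K := IntermediateField.adjoin ℚ {perronRoot A}
    have hyK : ∀ i, y i ∈ K := fun i =>
      H_le_of_forall_mem (G := K.toSubfield.toSubring.toAddSubgroup)
        (hx.mem_adjoin hA) (hH ▸ mem_H y i)
    have hli : LinearIndependent ℚ (fun i => (⟨y i, hyK i⟩ : K)) :=
      LinearIndependent.of_comp (IntermediateField.val K).toLinearMap hyQ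
    have : FiniteDimensional ℚ K := IntermediateField.adjoin.finiteDimensional hint
    rw [← IntermediateField.adjoin.finrank hint]
    simpa using hli.fintype_card_le_finrank
  · refine card_le_of_linearIndependent_of_mem_span
      (linearIndependent_mul (linearIndependent_pow (perronRoot A)) (hx.pos i₀).ne') (w := y)
      fun j => H_le_span y ?_
    rw [hH, mul_comm]
    exact hx.pow_mul_mem_H (mem_H x i₀) j

/-- Multiplication by a high power of the Perron–Frobenius eigenvalue has a positive matrix with
respect to a positive basis whose generated submonoid contains the Perron–Frobenius eigenvector. -/
theorem IsNormalizedPerronVector.exists_pos_matrix (hA : Primitive A)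
    (hx : IsNormalizedPerronVector A x) {m : ℕ} {y : Fin m → ℝ} (hy : ∀ i, 0 < y i)
    (hli : LinearIndependent ℤ y) (hxy : ∀ i, x i ∈ AddSubmonoid.closure (Set.range y))
    (hyx : ∀ i, y i ∈ H x) :
    ∃ (e : ℕ) (B : Matrix (Fin m) (Fin m) ℕ), 0 < e ∧ (∀ i j, 0 < B i j) ∧
      (B.map (fun n : ℕ => (n : ℝ))) *ᵥ y = perronRoot A ^ e • y := by
  have := hx.nonempty
  obtain ⟨-, q, hq, hpos⟩ := hA
  have hc : ∀ i, ∃ c : Fin s → ℤ, ∑ j, (c j : ℝ) * x j = y i := fun i => by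
    have h := hyx i
    rw [H, ← Submodule.span_int_eq_addSubgroupClosure, Submodule.mem_toAddSubgroup,
      Submodule.mem_span_range_iff_exists_fun] at h
    simpa using h
  have hd : ∀ i, ∃ d : Fin m → ℕ, ∑ j, (d j : ℝ) * y j = x i := fun i => by
    have h := hxy i
    rw [← Submodule.span_nat_eq_addSubmonoidClosure, Submodule.mem_toAddSubmonoid,
      Submodule.mem_span_range_iff_exists_fun] at h
    simpa using h
  choose c hc using hc
  choose d hd using hd
  -- If `y l` occurred in no `x j`, then `H x`, and so `y l` itself, would lie in the span of the
  -- other basis members. Thus `D` has no zero column, and the product with a positive matrix is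
  -- positive.
  have hd0 : ∀ l, ∃ j, 0 < d j l := by
    intro l
    by_contra! hcon
    have hz : ∀ j, x j ∈ Submodule.span ℤ (Set.image y {l}ᶜ) := fun j => by
      rw [← hd j]
      refine sum_mem fun i _ => ?_
      rcases eq_or_ne i l with rfl | hi
      · simp [Nat.le_zero.mp (hcon j)]
      · rw [← nsmul_eq_mul]
        exact nsmul_mem (Submodule.subset_span (Set.mem_image_of_mem y hi)) _
    refine hli.notMem_span_image (s := {l}ᶜ) (x := l) (by simp) ?_
    exact H_le_of_forall_mem (G := (Submodule.span ℤ (Set.image y {l}ᶜ)).toAddSubgroup) hz (hyx l)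
  set M := A.map (fun n : ℕ => (n : ℝ)) with hM
  have hev : ∀ᶠ N in Filter.atTop, ∀ i j, 0 < ((fun l => (c i l : ℝ)) ᵥ* ((M ^ q) ^ N)) j := by
    rw [Filter.eventually_all]
    intro i
    rw [Filter.eventually_all]
    refine eventually_vecMul_pow_pos hpos hx.pos (pow_mulVec_eigen hx.eigen q) _ ?_
    simpa [dotProduct, hc] using hy i
  obtain ⟨N, hN, hN1⟩ := (hev.and (Filter.eventually_ge_atTop 1)).exists
  have hMe : M ^ (q * N) = ((A ^ (q * N)).map (fun n : ℕ => (n : ℝ))) :=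
    (map_pow (Nat.castRingHom ℝ).mapMatrix A (q * N)).symm
  have hp : ∀ i j, ∃ p : ℕ, 0 < p ∧ (p : ℝ) = ((fun l => (c i l : ℝ)) ᵥ* (M ^ (q * N))) j := by
    intro i j
    have h1 := hN i j
    rw [← pow_mul] at h1
    have h2 : ((fun l => (c i l : ℝ)) ᵥ* (M ^ (q * N))) j
        = ((∑ l, c i l * ((A ^ (q * N)) l j : ℤ) : ℤ) : ℝ) := by
      rw [hMe]
      simp [vecMul, dotProduct]
    rw [h2] at h1 ⊢
    have h3 : 0 < ∑ l, c i l * ((A ^ (q * N)) l j : ℤ) := by exact_mod_cast h1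
    refine ⟨(∑ l, c i l * ((A ^ (q * N)) l j : ℤ)).toNat, by omega, ?_⟩
    exact_mod_cast congrArg (fun r : ℤ => (r : ℝ)) (Int.toNat_of_nonneg h3.le)
  choose p hp0 hp using hp
  -- The matrix `p` is `C A^(q N)`, so this is `B = C A^e D` with `e = q N`.
  refine ⟨q * N, Matrix.of p * Matrix.of d, Nat.mul_pos hq hN1, fun i l => ?_, ?_⟩
  · obtain ⟨j, hj⟩ := hd0 l
    exact Finset.sum_pos' (fun _ _ => Nat.zero_le _)
      ⟨j, Finset.mem_univ j, Nat.mul_pos (hp0 i j) hj⟩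
  · have hdx : ((Matrix.of d).map (fun n : ℕ => (n : ℝ))) *ᵥ y = x := funext hd
    have hpm : (Matrix.of p).map (fun n : ℕ => (n : ℝ)) =
        (Matrix.of fun i l => (c i l : ℝ)) * M ^ (q * N) := by
      ext i j
      exact hp i j
    have hcx : (Matrix.of fun i l => (c i l : ℝ)) *ᵥ x = y := funext hc
    have hmul : (Matrix.of p * Matrix.of d).map (fun n : ℕ => (n : ℝ)) =
        (Matrix.of p).map (fun n : ℕ => (n : ℝ)) * (Matrix.of d).map (fun n : ℕ => (n : ℝ)) :=
      Matrix.map_mul (f := Nat.castRingHom ℝ)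
    rw [hmul, ← mulVec_mulVec, hdx, hpm, ← mulVec_mulVec, pow_mulVec_eigen hx.eigen,
      mulVec_smul, hcx]

end PerronVector

end PerronClopen

/-! ### Construction of the `k × k` matrix and minimality of `k`. -/

theorem mainTheorem4 (s : ℕ) (A : Matrix (Fin s) (Fin s) ℕ) (hA : PerronClopen.Primitive A)
    (k : ℕ) (hk : 2 ≤ k) (hdeg : (minpoly ℚ (PerronClopen.perronRoot A)).natDegree = k) :
    (∃ A' : Matrix (Fin k) (Fin k) ℕ, PerronClopen.Primitive A' ∧
      ∃ α : ℝ, α ∈ IntermediateField.adjoin ℚ {PerronClopen.perronRoot A} ∧ 0 < α ∧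
        PerronClopen.S A' = α • PerronClopen.S A) ∧
    (∀ (l : ℕ) (P : Matrix (Fin l) (Fin l) ℕ), PerronClopen.Primitive P →
      ∀ α : ℝ, PerronClopen.S P = α • PerronClopen.S A → k ≤ l) := by
  open PerronClopen in
  have hne : Nonempty (Fin s) := by
    by_contra h
    rw [not_nonempty_iff] at h
    -- The empty matrix has empty spectrum, hence root `0` of degree `1`, which `k ≥ 2` excludes.
    have h0 : perronRoot A = 0 := by
      have : Subsingleton (Matrix (Fin s) (Fin s) ℂ) := inferInstance
      simp [perronRoot, spectralRadius, spectrum.of_subsingleton]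
    rw [h0, minpoly.zero, Polynomial.natDegree_X] at hdeg
    omega
  refine ⟨?_, fun l P hP α h => hdeg ▸ natDegree_minpoly_le_of_S_eq hA hP h⟩
  have hint : IsIntegral ℚ (perronRoot A) := by
    by_contra h
    rw [minpoly.eq_zero h, Polynomial.natDegree_zero] at hdeg
    omega
  obtain ⟨x, hx⟩ := hA.exists_isNormalizedPerronVector
  obtain ⟨m, y, hy, hli, hxy, hyx⟩ := exists_pos_basis x hx.pos
  have hH : H y = H x := by
    refine le_antisymm (H_le_of_forall_mem hyx) (H_le_of_forall_mem fun i => ?_)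
    exact AddSubmonoid.closure_le (S := (H y).toAddSubmonoid).mpr AddSubgroup.subset_closure (hxy i)
  obtain rfl : m = k := (hx.card_basis hA hint hli hH).trans hdeg
  obtain ⟨e, B, he, hB, hBy⟩ := hx.exists_pos_matrix hA hy hli hxy hyx
  have hm : Nonempty (Fin m) := ⟨⟨0, by omega⟩⟩
  have hBprim : Primitive B :=
    ⟨fun i j => by simp, 1, one_pos, fun i j => by simpa using hB i j⟩
  have hroot : perronRoot B = perronRoot A ^ e := perronRoot_eq_of_pos_eigenvector hy hBy
  have hσ : 0 < ∑ i, y i := Finset.sum_pos (fun i _ => hy i) Finset.univ_nonempty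
  set α := (∑ i, y i)⁻¹ with hα
  have hαpos : 0 < α := inv_pos.mpr hσ
  have hyn : IsNormalizedPerronVector B (α • y) := by
    refine ⟨fun i => mul_pos hαpos (hy i), ?_, ?_⟩
    · rw [Matrix.mulVec_smul, hBy, hroot, smul_comm]
    · simp only [Pi.smul_apply, smul_eq_mul, ← Finset.mul_sum]
      exact inv_mul_cancel₀ hσ.ne'
  refine ⟨B, hBprim, α, ?_, hαpos, ?_⟩
  · refine inv_mem (sum_mem fun i _ => ?_)
    exact H_le_of_forall_mem
      (G := (IntermediateField.adjoin ℚ {perronRoot A}).toSubfield.toSubring.toAddSubgroup)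
      (hx.mem_adjoin hA) (hyx i)
  · ext u
    rw [hyn.mem_S_iff hBprim, Set.mem_smul_set_iff_inv_smul_mem₀ hαpos.ne', hx.mem_S_iff hA]
    have hstep : ∀ N : ℕ, perronRoot B ^ N * u ∈ H (α • y) ↔
        perronRoot A ^ (e * N) * (α⁻¹ • u) ∈ H x := fun N => by
      rw [mem_H_smul_iff hαpos.ne', hH, hroot, ← pow_mul, smul_eq_mul, mul_left_comm]
    simp only [hstep]
    -- The exponents `e * N` are cofinal: `N ≤ e * N` as `e > 0`, and membership in `H x` survives
    -- further powers of `λ`.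
    refine ⟨fun ⟨N, hN⟩ => ⟨e * N, hN⟩, fun ⟨N, hN⟩ => ⟨N, ?_⟩⟩
    have h1 := hx.pow_mul_mem_H hN (e * N - N)
    rwa [← mul_assoc, ← pow_add, Nat.sub_add_cancel (Nat.le_mul_of_pos_left N he)] at h1
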